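/- Let $g\in L^2(\mathbb{R})$ be a function with $g(x)=0$ for $x<0$ whose restriction to $[0,\infty)$ is stably decreasing: it takes values in $[0,\infty)$, and for every $t>0$ there is $q(t)\in(0,1)$ such that $g(x+t)\le q(t)\,g(x)$ for all $x\ge 0$. Let $x_0\in[0,\infty]$ be the supremum of all $x\ge 0$ with $g(x)>0$ (with $x_0=0$ if there are none). For $\alpha,\beta>0$ consider the Gabor system $$\mathcal{G}(g;\alpha,\beta)=\{\pi_{\alpha m,\beta n}g\}_{m,n\in\mathbb{Z}},\qquad \pi_{t,\omega}g(x)=e^{2\pi i\omega x}g(x-t).$$ It is called a frame in the complex space $L^2(\mathbb{R})$ if there are constants $A,B>0$ such that $$A\|h\|^2\le\sum_{m,n\in\mathbb{Z}}|(h,\pi_{\alpha m,\beta n}g)|^2\le B\|h\|^2\qquad\text{for all } h\in L^2(\mathbb{R}).$$ If $x_0<\infty$, then the limit $g(x_0-)=\lim_{x\to x_0-}g(x)$ exists and is a non-negative real number. Moreover, the following hold for all $\alpha,\beta>0$. 1. If $x_0=\infty$, then $\mathcal{G}(g;\alpha,\beta)$ is a frame if and only if $\alpha\beta\le 1$. 2.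 If $x_0<\infty$ and $g(x_0-)>0$, then $\mathcal{G}(g;\alpha,\beta)$ is a frame if and only if $\alpha\beta\le1$ and $\alpha\le x_0$. 3. If $x_0<\infty$ and $g(x_0-)=0$, then $\mathcal{G}(g;\alpha,\beta)$ is a frame if and only if $\alpha\beta\le 1$ and $\alpha<x_0$. -/

import Mathlib

open MeasureTheory Filter Topology
open scoped ENNReal

noncomputable section

/-- The time-frequency shift `π_{t,ω} g (x) = e^{2πiωx} g(x - t)`. -/
def timeFreqShift (t ω : ℝ) (g : ℝ → ℂ) (x : ℝ) : ℂ :=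
  Complex.exp (2 * Real.pi * Complex.I * ω * x) * g (x - t)

/-- Time-frequency shifts preserve square-integrability. -/
theorem memLp_timeFreqShift {g : ℝ → ℂ} (hg : MemLp g 2 volume) (t ω : ℝ) :
    MemLp (timeFreqShift t ω g) 2 volume := by
  have h1 : MemLp (fun x => g (x - t)) 2 volume :=
    hg.comp_measurePreserving (measurePreserving_sub_right volume t)
  refine h1.of_le ?_ (Eventually.of_forall fun x => ?_)
  · exact (Continuous.aestronglyMeasurable (by fun_prop)).mul h1.1
  · have h2 : (2 * Real.pi * Complex.I * ω * x : ℂ)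
        = ((2 * Real.pi * ω * x : ℝ) : ℂ) * Complex.I := by
      push_cast; ring
    rw [timeFreqShift, norm_mul, h2, Complex.norm_exp_ofReal_mul_I, one_mul]

/-- The Gabor system `{π_{α m, β n} g}`, `m, n ∈ ℤ`, as a family in `L²(ℝ)` (complex valued). -/
def gaborSystem (g : ℝ → ℂ) (hg : MemLp g 2 volume) (α β : ℝ) :
    ℤ × ℤ → Lp ℂ 2 (volume : Measure ℝ) :=
  fun p => (memLp_timeFreqShift hg (α * p.1) (β * p.2)).toLp
    (timeFreqShift (α * p.1) (β * p.2) g)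

/-- A family `v` in a Hilbert space is a frame: there are `A, B > 0` such that
`A ‖h‖² ≤ ∑ᵢ |(h, vᵢ)|² ≤ B ‖h‖²` for all `h`, the series being convergent. -/
def IsFrame {ι H : Type*} [NormedAddCommGroup H] [InnerProductSpace ℂ H] (v : ι → H) : Prop :=
  ∃ A B : ℝ, 0 < A ∧ 0 < B ∧ ∀ h : H,
    Summable (fun i => ‖inner ℂ (v i) h‖ ^ 2) ∧
    A * ‖h‖ ^ 2 ≤ ∑' i, ‖inner ℂ (v i) h‖ ^ 2 ∧
    ∑' i, ‖inner ℂ (v i) h‖ ^ 2 ≤ B * ‖h‖ ^ 2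

/-- `g` is stably decreasing on `[0, ∞)`: it maps `[0, ∞)` to `[0, ∞)`, and for every `t > 0`
there is `0 < q < 1` with `g (x + t) ≤ q g(x)` for all `x ≥ 0`. -/
structure StablyDecreasing (g : ℝ → ℝ) : Prop where
  nonneg : ∀ x, 0 ≤ x → 0 ≤ g x
  decreasing : ∀ t, 0 < t → ∃ q, 0 < q ∧ q < 1 ∧ ∀ x, 0 ≤ x → g (x + t) ≤ q * g x

/-- The supremum in `[0, ∞]` of the `x ≥ 0` such that `g(x) > 0` (it is `0` if there are none). -/
def supPos (g : ℝ → ℝ) : ℝ≥0∞ :=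
  ⨆ x ∈ {x : ℝ | 0 ≤ x ∧ 0 < g x}, ENNReal.ofReal x

end

/-! Write `T = β⁻¹`. Periodizing with period `T` and applying Parseval in the modulation index turns
the frame sum into `T` times the integral over `x ∈ (0, T]` of `∑ₘ |∑ₖ g(x + Tk - αm) h(x + Tk)|²`
(`tsum_enorm_sq_inner_gaborSystem`). The question becomes whether the matrices `g(x + Tk - αm)` are
bounded above and below on `ℓ²(ℤ)`, uniformly in `x`. The upper bound always holds, by geometric
decay and the Schur test.

Lower bound, for `α ≤ T` and `g ≥ d > 0` on `[0, α)`: stable decrease with step `α` makes row `m` at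
most `q` times row `m + 1`, except in one entry. Solving for that entry bounds the absolute row sums
`∑ₖ g |cₖ|` by `q` times the next one plus an error from the actual row values. Summing squares, the
actual values control the absolute sums, and these control `c`.

Failure: if `T < α`, long finite blocks have more columns than relevant rows, and a kernel vector is
almost annihilated (`not_isFrame_gaborSystem_of_lt`). If `g` vanishes beyond `α` and tends to `0` at
`α-`, some column has a single, arbitrarily small entry (`not_isFrame_gaborSystem_of_tendsto_zero`);
this covers both `α > x₀` and `α = x₀` with `g(x₀-) = 0`. -/

namespace StablyDecreasing

/-! ### Monotonicity, one-sided limits and geometric decay. -/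

variable {g : ℝ → ℝ}

theorem antitoneOn (hd : StablyDecreasing g) : AntitoneOn g (Set.Ici 0) := by
  intro x hx y _ hxy
  rcases hxy.eq_or_lt with rfl | h
  · exact le_rfl
  · obtain ⟨q, _, hq1, hq⟩ := hd.decreasing (y - x) (sub_pos.2 h)
    have h1 := hq x hx
    rw [add_sub_cancel] at h1
    exact h1.trans (mul_le_of_le_one_left (hd.nonneg x hx) hq1.le)

theorem nonneg_of_eq_zero (hd : StablyDecreasing g) (hneg : ∀ x, x < 0 → g x = 0) (x : ℝ) :
    0 ≤ g x := by
  rcases lt_or_ge x 0 with h | h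
  · exact (hneg x h).ge
  · exact hd.nonneg x h

theorem le_apply_zero (hd : StablyDecreasing g) (hneg : ∀ x, x < 0 → g x = 0) (x : ℝ) :
    g x ≤ g 0 := by
  rcases lt_or_ge x 0 with h | h
  · exact (hneg x h).trans_le (hd.nonneg 0 le_rfl)
  · exact hd.antitoneOn (Set.mem_Ici.2 le_rfl) h h

/-- A globally antitone function agreeing with `g` on `[0, ∞)`. -/
theorem antitone_comp_max (hd : StablyDecreasing g) : Antitone fun x => g (max x 0) :=
  fun _ _ h => hd.antitoneOn (Set.mem_Ici.2 (le_max_right _ _)) (Set.mem_Ici.2 (le_max_right _ _))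
    (max_le_max_right 0 h)

theorem measurable (hd : StablyDecreasing g) (hneg : ∀ x, x < 0 → g x = 0) : Measurable g := by
  have h : g = (Set.Ici (0 : ℝ)).indicator fun x => g (max x 0) := by
    ext x
    rcases lt_or_ge x 0 with hx | hx
    · rw [hneg x hx, Set.indicator_of_notMem (by simpa using hx)]
    · rw [Set.indicator_of_mem (Set.mem_Ici.2 hx), max_eq_left hx]
  rw [h]
  exact hd.antitone_comp_max.measurable.indicator measurableSet_Ici

theorem exists_tendsto_nhdsGT (hd : StablyDecreasing g) (hneg : ∀ x, x < 0 → g x = 0) (y : ℝ) :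
    ∃ L, Tendsto g (𝓝[>] y) (𝓝 L) := by
  rcases lt_or_ge y 0 with hy | hy
  · refine ⟨0, tendsto_const_nhds.congr' ?_⟩
    filter_upwards [mem_nhdsWithin_of_mem_nhds (Iio_mem_nhds hy)] with x hx
    exact (hneg x hx).symm
  · refine ⟨_, (hd.antitone_comp_max.tendsto_rightLim y).congr' ?_⟩
    filter_upwards [self_mem_nhdsWithin] with x hx
    rw [max_eq_left (hy.trans (Set.mem_Ioi.1 hx).le)]

theorem exists_tendsto_nhdsLT (hd : StablyDecreasing g) (hneg : ∀ x, x < 0 → g x = 0) (y : ℝ) :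
    ∃ L, 0 ≤ L ∧ Tendsto g (𝓝[<] y) (𝓝 L) ∧ ∀ x, 0 ≤ x → x < y → L ≤ g x := by
  -- The value `y = 0` matters: it is `x₀` when `g` vanishes on `(0, ∞)`, and the left limit is then
  -- `0`.
  rcases le_or_gt y 0 with hy | hy
  · refine ⟨0, le_rfl, tendsto_const_nhds.congr' ?_, fun x hx _ => hd.nonneg x hx⟩
    filter_upwards [self_mem_nhdsWithin] with x hx
    exact (hneg x ((Set.mem_Iio.1 hx).trans_le hy)).symm
  · have h := (hd.antitone_comp_max.tendsto_leftLim y).congr' (f₂ := g) (by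
      filter_upwards [mem_nhdsWithin_of_mem_nhds (Ioi_mem_nhds hy)] with x hx
      rw [max_eq_left (Set.mem_Ioi.1 hx).le])
    refine ⟨_, ge_of_tendsto' h (hd.nonneg_of_eq_zero hneg), h, fun x hx hxy => ?_⟩
    simpa [max_eq_left hx] using hd.antitone_comp_max.leftLim_le hxy

theorem le_pow_mul {q t : ℝ} (hq0 : 0 ≤ q) (ht : 0 ≤ t) (hq : ∀ x, 0 ≤ x → g (x + t) ≤ q * g x)
    {x : ℝ} (hx : 0 ≤ x) (n : ℕ) : g (x + t * n) ≤ q ^ n * g x := by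
  induction n with
  | zero => simp
  | succ n ih =>
    calc g (x + t * (n + 1 : ℕ)) = g (x + t * n + t) := by push_cast; ring_nf
      _ ≤ q * g (x + t * n) := hq _ (by positivity)
      _ ≤ q * (q ^ n * g x) := by gcongr
      _ = q ^ (n + 1) * g x := by ring

theorem exists_tsum_le (hd : StablyDecreasing g) (hneg : ∀ x, x < 0 → g x = 0) {t : ℝ}
    (ht : 0 < t) : ∃ C : ℝ, 0 < C ∧
      ∀ x, ∑' m : ℤ, ENNReal.ofReal (g (x + t * m)) ≤ ENNReal.ofReal C := by
  obtain ⟨q, hq0, hq1, hq⟩ := hd.decreasing t ht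
  have hpos : 0 < 1 - q := sub_pos.2 hq1
  have h0 := hd.nonneg 0 le_rfl
  -- The summand `1` keeps the constant positive when `g 0 = 0`. Below, `y` is the translate of `x`
  -- in `[0, t)`, so terms of negative index vanish.
  refine ⟨(g 0 + 1) / (1 - q), by positivity, fun x => ?_⟩
  have hx1 : 0 ≤ x + t * (⌈-x / t⌉ : ℤ) := by
    have := (div_le_iff₀ ht).1 (Int.le_ceil (-x / t)); linarith
  have hx2 : x + t * (⌈-x / t⌉ : ℤ) < t := by
    have := (lt_div_iff₀ ht).1 (sub_lt_iff_lt_add.2 (Int.ceil_lt_add_one (-x / t)))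
    nlinarith
  set y := x + t * (⌈-x / t⌉ : ℤ) with hy
  calc ∑' m : ℤ, ENNReal.ofReal (g (x + t * m))
      = ∑' m : ℤ, ENNReal.ofReal (g (y + t * m)) := by
        rw [← (Equiv.addRight ⌈-x / t⌉).tsum_eq]
        congr! 3 with m
        simp only [Equiv.coe_addRight, hy]; push_cast; ring_nf
    _ = ∑' n : ℕ, ENNReal.ofReal (g (y + t * n)) := by
        rw [← (Nat.cast_injective (R := ℤ)).tsum_eq (f := fun m : ℤ => ENNReal.ofReal (g (y + t * m)))]
        · simp
        · intro m hm
          by_contra hmn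
          have hm0 : m ≤ -1 := by
            by_contra h
            exact hmn ⟨m.toNat, Int.toNat_of_nonneg (by omega)⟩
          refine hm ?_
          have : (m : ℝ) ≤ -1 := by exact_mod_cast hm0
          simp only [hneg (y + t * m) (by nlinarith), ENNReal.ofReal_zero]
    _ ≤ ∑' n : ℕ, ENNReal.ofReal (q ^ n * (g 0 + 1)) := by
        refine ENNReal.tsum_le_tsum fun n => ENNReal.ofReal_le_ofReal ?_
        refine (le_pow_mul hq0.le ht.le hq hx1 n).trans ?_
        gcongr
        linarith [hd.le_apply_zero hneg y]
    _ = ENNReal.ofReal ((g 0 + 1) / (1 - q)) := by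
        rw [← ENNReal.ofReal_tsum_of_nonneg (fun n => by positivity)
          ((summable_geometric_of_lt_one hq0.le hq1).mul_right _), tsum_mul_right,
          tsum_geometric_of_lt_one hq0.le hq1, inv_mul_eq_div]

end StablyDecreasing

/-! ### The Schur test in `ℝ≥0∞`. -/

theorem ENNReal.two_mul_le_sq_add_sq (x y : ℝ≥0∞) : 2 * (x * y) ≤ x ^ 2 + y ^ 2 := by
  wlog h : x ≤ y generalizing x y
  · rw [mul_comm x, add_comm]; exact this y x (le_of_not_ge h)
  obtain ⟨d, rfl⟩ := exists_add_of_le h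
  calc 2 * (x * (x + d)) ≤ 2 * (x * (x + d)) + d ^ 2 := le_self_add
    _ = x ^ 2 + (x + d) ^ 2 := by ring

/-- Cauchy–Schwarz with weights `a`, obtained by applying `2uv ≤ u² + v²` inside the double sum, so
that no finiteness is needed. -/
theorem ENNReal.sq_tsum_mul_le {ι : Type*} (a c : ι → ℝ≥0∞) :
    (∑' k, a k * c k) ^ 2 ≤ (∑' k, a k) * ∑' k, a k * c k ^ 2 := by
  have h2 : 2 * (∑' k, a k * c k) ^ 2 ≤ 2 * ((∑' k, a k) * ∑' k, a k * c k ^ 2) := by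
    calc 2 * (∑' k, a k * c k) ^ 2 = ∑' k, ∑' l, a k * a l * (2 * (c k * c l)) := by
          rw [sq, ← ENNReal.tsum_mul_right, ← ENNReal.tsum_mul_left]
          refine tsum_congr fun k => ?_
          rw [← ENNReal.tsum_mul_left, ← ENNReal.tsum_mul_left]
          exact tsum_congr fun l => by ring
      _ ≤ ∑' k, ∑' l, (a l * (a k * c k ^ 2) + a k * (a l * c l ^ 2)) := by
          refine ENNReal.tsum_le_tsum fun k => ENNReal.tsum_le_tsum fun l => ?_
          calc a k * a l * (2 * (c k * c l)) ≤ a k * a l * (c k ^ 2 + c l ^ 2) := by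
                gcongr; exact two_mul_le_sq_add_sq _ _
            _ = _ := by ring
      _ = 2 * ((∑' k, a k) * ∑' k, a k * c k ^ 2) := by
          simp_rw [ENNReal.tsum_add, ENNReal.tsum_mul_left, ENNReal.tsum_mul_right]
          rw [ENNReal.tsum_mul_left]
          ring
  exact (ENNReal.mul_le_mul_iff_right (by simp) (by simp)).1 h2

/-- The Schur test. -/
theorem ENNReal.tsum_sq_tsum_mul_le {ι κ : Type*} {a : ι → κ → ℝ≥0∞} {C D : ℝ≥0∞}
    (hrow : ∀ m, ∑' k, a m k ≤ C) (hcol : ∀ k, ∑' m, a m k ≤ D) (c : κ → ℝ≥0∞) :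
    ∑' m, (∑' k, a m k * c k) ^ 2 ≤ C * D * ∑' k, c k ^ 2 := by
  calc ∑' m, (∑' k, a m k * c k) ^ 2 ≤ ∑' m, C * ∑' k, a m k * c k ^ 2 := by
        refine ENNReal.tsum_le_tsum fun m => (sq_tsum_mul_le _ _).trans ?_
        gcongr; exact hrow m
    _ = C * ∑' k, (∑' m, a m k) * c k ^ 2 := by
        rw [ENNReal.tsum_mul_left, ENNReal.tsum_comm]
        simp_rw [ENNReal.tsum_mul_right]
    _ ≤ C * ∑' k, D * c k ^ 2 := by
        gcongr with k; exact hcol k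
    _ = _ := by rw [ENNReal.tsum_mul_left, mul_assoc]

/-! ### Contraction between consecutive rows. -/

theorem sq_add_le_of_convex {q : ℝ} (hq0 : 0 < q) (hq1 : q < 1) {z z' w : ℝ} (hz : 0 ≤ z)
    (h : z ≤ q * z' + w) : z ^ 2 ≤ q * z' ^ 2 + w ^ 2 / (1 - q) := by
  have hp : 0 < 1 - q := sub_pos.2 hq1
  have h1 : z ^ 2 ≤ (q * z' + w) ^ 2 := by gcongr
  -- The defect in the convexity of the square at `z'` and `w / (1 - q)`, with weights `q` and `1 -
  -- q`.
  have h2 : q * z' ^ 2 + w ^ 2 / (1 - q) - (q * z' + w) ^ 2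
      = q * ((1 - q) * z' - w) ^ 2 / (1 - q) := by
    field_simp; ring
  have h3 : 0 ≤ q * ((1 - q) * z' - w) ^ 2 / (1 - q) := by positivity
  linarith

/-- A nonnegative square-summable sequence which contracts up to an error is controlled by the
error. -/
theorem tsum_sq_le_of_contraction {q : ℝ} (hq0 : 0 < q) (hq1 : q < 1) {z y : ℤ → ℝ}
    (hz0 : ∀ m, 0 ≤ z m) (hzs : Summable fun m => z m ^ 2)
    (hys : Summable fun m => y m ^ 2)
    (h : ∀ m, z m ≤ q * z (m + 1) + (y m + q * y (m + 1))) :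
    (1 - q) ^ 2 * ∑' m, z m ^ 2 ≤ 4 * ∑' m, y m ^ 2 := by
  have hp : 0 < 1 - q := sub_pos.2 hq1
  have hshift : ∀ f : ℤ → ℝ, ∑' m, f (m + 1) = ∑' m, f m :=
    fun f => (Equiv.addRight (1 : ℤ)).tsum_eq f
  have hshift' : ∀ f : ℤ → ℝ, Summable f → Summable fun m => f (m + 1) :=
    fun f hf => (Equiv.addRight (1 : ℤ)).summable_iff.2 hf
  have hz' := hshift' _ hzs
  have hy' := hshift' _ hys
  have key : ∀ m, (1 - q) * z m ^ 2 ≤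
      (1 - q) * q * z (m + 1) ^ 2 + (2 * y m ^ 2 + 2 * y (m + 1) ^ 2) := by
    intro m
    have h1 := sq_add_le_of_convex hq0 hq1 (hz0 m) (h m)
    have h2 := mul_le_mul_of_nonneg_left h1 hp.le
    rw [mul_add, mul_div_cancel₀ _ hp.ne'] at h2
    nlinarith [sq_nonneg (y m - q * y (m + 1)), sq_nonneg (y (m + 1)), mul_pos hq0 hp]
  have hsum := Summable.tsum_le_tsum key (hzs.mul_left _)
    ((hz'.mul_left _).add ((hys.mul_left _).add (hy'.mul_left _)))
  rw [Summable.tsum_add (hz'.mul_left _) ((hys.mul_left _).add (hy'.mul_left _)),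
    Summable.tsum_add (hys.mul_left _) (hy'.mul_left _)] at hsum
  simp_rw [tsum_mul_left] at hsum
  -- By shift invariance the same finite sum of `z²` stands on both sides, so its `q`-multiple can
  -- be absorbed.
  rw [hshift (fun m => z m ^ 2), hshift (fun m => y m ^ 2)] at hsum
  nlinarith

/-- Comparison of two consecutive rows of a matrix with nonnegative entries, where the first one
is dominated by `q` times the second one except for one entry. -/
theorem tsum_mul_norm_le_of_row_le {q : ℝ} {a b : ℤ → ℝ} {c : ℤ → ℂ} {k₀ : ℤ}
    (ha0 : ∀ k, 0 ≤ a k) (hb0 : b k₀ = 0) (hab : ∀ k, k ≠ k₀ → a k ≤ q * b k) (hq : 0 ≤ q)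
    (ha : Summable fun k => a k * ‖c k‖) (hb : Summable fun k => b k * ‖c k‖) :
    ∑' k, a k * ‖c k‖ ≤ q * ∑' k, b k * ‖c k‖ +
      (‖∑' k, (a k : ℂ) * c k‖ + q * ‖∑' k, (b k : ℂ) * c k‖) := by
  have hbnn : ∀ k, 0 ≤ q * b k := fun k => by
    by_cases hk : k = k₀
    · rw [hk, hb0, mul_zero]
    · exact (ha0 k).trans (hab k hk)
  have hnb : Summable fun k => ‖(q : ℂ) * ((b k : ℂ) * c k)‖ := by
    have : (fun k => ‖(q : ℂ) * ((b k : ℂ) * c k)‖) = fun k => q * (b k * ‖c k‖) := by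
      ext k
      rw [← mul_assoc, norm_mul, ← Complex.ofReal_mul, Complex.norm_of_nonneg (hbnn k), mul_assoc]
    rw [this]; exact hb.mul_left _
  have hna : Summable fun k => ‖(a k : ℂ) * c k‖ := by
    simp_rw [norm_mul, Complex.norm_of_nonneg (ha0 _)]; exact ha
  have hD : HasSum (fun k => (a k : ℂ) * c k - q * ((b k : ℂ) * c k))
      (∑' k, (a k : ℂ) * c k - ∑' k, (q : ℂ) * ((b k : ℂ) * c k)) :=
    hna.of_norm.hasSum.sub hnb.of_norm.hasSum
  have hDn : ‖∑' k, (a k : ℂ) * c k - ∑' k, (q : ℂ) * ((b k : ℂ) * c k)‖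
      ≤ ‖∑' k, (a k : ℂ) * c k‖ + q * ‖∑' k, (b k : ℂ) * c k‖ := by
    refine (norm_sub_le _ _).trans ?_
    rw [tsum_mul_left, norm_mul, Complex.norm_of_nonneg hq]
  -- Isolate the exceptional entry in (row `a`) - `q` (row `b`). As `b k₀ = 0`, it contributes
  -- exactly `a k₀ * c k₀`; all other coefficients `a k - q * b k` are nonpositive, so their moduli
  -- are `q * b k - a k`.
  have hE := hD.summable.tsum_eq_add_tsum_ite k₀
  rw [hD.tsum_eq] at hE
  simp only [hb0, Complex.ofReal_zero, zero_mul, mul_zero, sub_zero] at hE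
  set r : ℤ → ℝ := fun k => if k = k₀ then 0 else q * (b k * ‖c k‖) - a k * ‖c k‖ with hr
  have hrs : Summable r := by
    have h1 := ((hb.mul_left q).sub ha).indicator {k | k ≠ k₀}
    refine h1.congr fun k => ?_
    by_cases hk : k = k₀ <;> simp [hr, hk]
  have hR : ‖∑' k, (if k = k₀ then 0 else (a k : ℂ) * c k - q * ((b k : ℂ) * c k))‖ ≤ ∑' k, r k := by
    refine tsum_of_norm_bounded hrs.hasSum fun k => ?_
    by_cases hk : k = k₀
    · simp [hr, hk]
    · simp only [hr, hk, if_false]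
      have : (a k : ℂ) * c k - q * ((b k : ℂ) * c k) = ((a k - q * b k : ℝ) : ℂ) * c k := by
        push_cast; ring
      rw [this, norm_mul, Complex.norm_real, Real.norm_of_nonpos (sub_nonpos.2 (hab k hk))]
      linarith
  have h0 : a k₀ * ‖c k₀‖ ≤ ‖∑' k, (a k : ℂ) * c k - ∑' k, (q : ℂ) * ((b k : ℂ) * c k)‖
      + ∑' k, r k := by
    calc a k₀ * ‖c k₀‖ = ‖(a k₀ : ℂ) * c k₀‖ := by rw [norm_mul, Complex.norm_of_nonneg (ha0 _)]
      _ = ‖(∑' k, (a k : ℂ) * c k - ∑' k, (q : ℂ) * ((b k : ℂ) * c k)) -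
          ∑' k, (if k = k₀ then 0 else (a k : ℂ) * c k - q * ((b k : ℂ) * c k))‖ := by
          rw [hE, add_sub_cancel_right]
      _ ≤ _ := (norm_sub_le _ _).trans (by gcongr)
  have hsum : a k₀ * ‖c k₀‖ + q * ∑' k, b k * ‖c k‖ = ∑' k, a k * ‖c k‖ + ∑' k, r k := by
    rw [ha.tsum_eq_add_tsum_ite k₀, ← tsum_mul_left, add_assoc]
    congr 1
    rw [← Summable.tsum_add _ hrs]
    · refine tsum_congr fun k => ?_
      by_cases hk : k = k₀
      · simp [hr, hk, hb0]
      · simp [hr, hk]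
    · refine (ha.indicator {k | k ≠ k₀}).congr fun k => ?_
      by_cases hk : k = k₀ <;> simp [hk]
  linarith

/-! ### Uniform upper and lower bounds for the fiber matrices. -/

/-- The row-column bounds of the matrices `g (x + Tk - αm)`. -/
theorem StablyDecreasing.exists_tsum_sq_le {g : ℝ → ℝ} (hd : StablyDecreasing g)
    (hneg : ∀ x, x < 0 → g x = 0) {α T : ℝ} (hα : 0 < α) (hT : 0 < T) :
    ∃ B : ℝ, 0 < B ∧ ∀ (x : ℝ) (c : ℤ → ℝ≥0∞),
      ∑' m : ℤ, (∑' k : ℤ, ENNReal.ofReal (g (x + T * k - α * m)) * c k) ^ 2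
        ≤ ENNReal.ofReal B * ∑' k, c k ^ 2 := by
  obtain ⟨C, hC0, hC⟩ := hd.exists_tsum_le hneg hT
  obtain ⟨D, hD0, hD⟩ := hd.exists_tsum_le hneg hα
  refine ⟨C * D, by positivity, fun x c => ?_⟩
  rw [ENNReal.ofReal_mul hC0.le]
  refine ENNReal.tsum_sq_tsum_mul_le (fun m => ?_) (fun k => ?_) c
  · refine le_trans (le_of_eq ?_) (hC (x - α * m))
    congr! 3 with k
    ring_nf
  · refine le_trans (le_of_eq ?_) (hD (x + T * k))
    rw [← (Equiv.neg ℤ).tsum_eq]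
    congr! 3 with m
    simp [sub_eq_add_neg]

theorem StablyDecreasing.exists_le_tsum_sq {g : ℝ → ℝ} (hd : StablyDecreasing g)
    (hneg : ∀ x, x < 0 → g x = 0) {α T d : ℝ} (hα : 0 < α) (hαT : α ≤ T) (hd0 : 0 < d)
    (hgd : ∀ x, 0 ≤ x → x < α → d ≤ g x) :
    ∃ A : ℝ, 0 < A ∧ ∀ (x : ℝ) (c : ℤ → ℂ), ∑' k, ‖c k‖ₑ ^ 2 ≠ ∞ →
      ENNReal.ofReal A * ∑' k, ‖c k‖ₑ ^ 2 ≤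
        ∑' m : ℤ, ‖∑' k : ℤ, (g (x + T * k - α * m) : ℂ) * c k‖ₑ ^ 2 := by
  have hT : 0 < T := hα.trans_le hαT
  have hg0 := hd.nonneg_of_eq_zero hneg
  obtain ⟨B, hB0, hB⟩ := hd.exists_tsum_sq_le hneg hα hT
  obtain ⟨q, hq0, hq1, hq⟩ := hd.decreasing α hα
  have hp : 0 < 1 - q := sub_pos.2 hq1
  -- The factor `(1 - q)² / 4` comes from the contraction, `d²` from recovering `c` from the
  -- absolute row sums.
  refine ⟨(1 - q) ^ 2 * d ^ 2 / 4, by positivity, fun x c hc => ?_⟩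
  have hterm : ∀ m k : ℤ, ENNReal.ofReal (g (x + T * k - α * m)) * ‖c k‖ₑ
      = ENNReal.ofReal (g (x + T * k - α * m) * ‖c k‖) := fun m k => by
    rw [ENNReal.ofReal_mul (hg0 _), ofReal_norm]
  have hZ := (hB x fun k => ‖c k‖ₑ).trans_lt (ENNReal.mul_lt_top ENNReal.ofReal_lt_top hc.lt_top)
  simp_rw [hterm] at hZ
  have hnn : ∀ m k : ℤ, 0 ≤ g (x + T * k - α * m) * ‖c k‖ :=
    fun m k => mul_nonneg (hg0 _) (norm_nonneg _)
  have hsum : ∀ m : ℤ, Summable fun k : ℤ => g (x + T * k - α * m) * ‖c k‖ := by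
    intro m
    have h1 : ∑' k : ℤ, ENNReal.ofReal (g (x + T * k - α * m) * ‖c k‖) ≠ ∞ := by
      intro h
      have := ENNReal.ne_top_of_tsum_ne_top hZ.ne m
      rw [h] at this
      simp at this
    refine (ENNReal.summable_toReal h1).congr fun k => ?_
    rw [ENNReal.toReal_ofReal (hnn m k)]
  set z : ℤ → ℝ := fun m => ∑' k : ℤ, g (x + T * k - α * m) * ‖c k‖ with hz
  set y : ℤ → ℝ := fun m => ‖∑' k : ℤ, (g (x + T * k - α * m) : ℂ) * c k‖ with hy
  have hz0 : ∀ m, 0 ≤ z m := fun m => tsum_nonneg (hnn m)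
  have hyz : ∀ m, y m ≤ z m := fun m => tsum_of_norm_bounded (hsum m).hasSum fun k => by
    rw [norm_mul, Complex.norm_of_nonneg (hg0 _)]
  have hzs : Summable fun m => z m ^ 2 := by
    refine (ENNReal.summable_toReal hZ.ne).congr fun m => ?_
    rw [← ENNReal.ofReal_tsum_of_nonneg (hnn m) (hsum m), ← ENNReal.ofReal_pow (hz0 m),
      ENNReal.toReal_ofReal (sq_nonneg _)]
  have hys : Summable fun m => y m ^ 2 :=
    hzs.of_nonneg_of_le (fun m => sq_nonneg _) fun m =>
      pow_le_pow_left₀ (norm_nonneg _) (hyz m) 2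
  have hcontr : ∀ m, z m ≤ q * z (m + 1) + (y m + q * y (m + 1)) := by
    intro m
    -- `⌈s⌉` is the first column where row `m + 1` has a nonnegative argument, and `⌈s⌉ - 1` is the
    -- exceptional one. Further left, the argument in row `m` is negative too, because `α ≤ T`.
    set s : ℝ := (α * (m + 1) - x) / T
    have hk1 : x + T * (⌈s⌉ - 1 : ℤ) - α * (m + 1 : ℤ) < 0 := by
      have h1 := (lt_div_iff₀ hT).1 (sub_lt_iff_lt_add.2 (Int.ceil_lt_add_one s))
      push_cast; linarith
    have hk2 : 0 ≤ x + T * (⌈s⌉ : ℤ) - α * (m + 1 : ℤ) := by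
      have h1 := (div_le_iff₀ hT).1 (Int.le_ceil s)
      push_cast; linarith
    refine tsum_mul_norm_le_of_row_le (k₀ := ⌈s⌉ - 1) (fun k => hg0 _) (hneg _ hk1) ?_ hq0.le
      (hsum m) (hsum (m + 1))
    intro k hk
    rcases lt_or_gt_of_ne hk with h | h
    · rw [hneg _ ?_]
      · exact mul_nonneg hq0.le (hg0 _)
      · have h2 : (k : ℝ) ≤ (⌈s⌉ - 1 : ℤ) - 1 := by exact_mod_cast Int.le_sub_one_of_lt h
        push_cast at hk1 h2 ⊢
        nlinarith
    · have h2 : ((⌈s⌉ : ℤ) : ℝ) ≤ k := by exact_mod_cast (by omega : ⌈s⌉ ≤ k)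
      have h3 := hq (x + T * k - α * (m + 1 : ℤ)) (by nlinarith)
      convert h3 using 2
      push_cast; ring
  have hmain := tsum_sq_le_of_contraction hq0 hq1 hz0 hzs hys hcontr
  -- the entries close to the diagonal control `c`
  set μ : ℤ → ℤ := fun k => ⌊(x + T * k) / α⌋ with hμ
  have hμ1 : ∀ k, 0 ≤ x + T * k - α * μ k := fun k => by
    have := (le_div_iff₀ hα).1 (Int.floor_le ((x + T * k) / α)); linarith
  have hμ2 : ∀ k, x + T * k - α * μ k < α := fun k => by
    have := (div_lt_iff₀ hα).1 (Int.lt_floor_add_one ((x + T * k) / α)); linarith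
  -- Consecutive points `x + Tk` are at least `α` apart, hence lie in different cells of length `α`.
  have hμinj : Function.Injective μ := by
    refine StrictMono.injective (strictMono_int_of_lt_succ fun k => ?_)
    have h1 := hμ2 k
    have h2 := hμ1 k
    refine Int.lt_of_add_one_le (Int.le_floor.2 ((le_div_iff₀ hα).2 ?_))
    push_cast
    nlinarith
  have hcz : ∀ k, d ^ 2 * ‖c k‖ ^ 2 ≤ z (μ k) ^ 2 := fun k => by
    rw [← mul_pow]
    gcongr
    calc d * ‖c k‖ ≤ g (x + T * k - α * μ k) * ‖c k‖ := by gcongr; exact hgd _ (hμ1 k) (hμ2 k)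
      _ ≤ _ := (hsum (μ k)).le_tsum k fun j _ => hnn _ j
  have hzμ : Summable fun k => z (μ k) ^ 2 := hzs.comp_injective hμinj
  have hcs : Summable fun k => ‖c k‖ ^ 2 := by
    refine (ENNReal.summable_toReal hc).congr fun k => ?_
    simp
  have h1 : d ^ 2 * ∑' k, ‖c k‖ ^ 2 ≤ ∑' m, z m ^ 2 := by
    rw [← tsum_mul_left]
    exact (Summable.tsum_le_tsum hcz (hcs.mul_left _) hzμ).trans
      (tsum_comp_le_tsum_of_inj hzs (fun m => sq_nonneg _) hμinj)
  have h2 : (1 - q) ^ 2 * d ^ 2 / 4 * ∑' k, ‖c k‖ ^ 2 ≤ ∑' m, y m ^ 2 := by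
    nlinarith [mul_le_mul_of_nonneg_left h1 (sq_nonneg (1 - q))]
  have h3 : ∀ (f : ℤ → ℂ), Summable (fun k => ‖f k‖ ^ 2) →
      ∑' k, ‖f k‖ₑ ^ 2 = ENNReal.ofReal (∑' k, ‖f k‖ ^ 2) := fun f hf => by
    rw [ENNReal.ofReal_tsum_of_nonneg (fun _ => sq_nonneg _) hf]
    refine tsum_congr fun k => ?_
    rw [ENNReal.ofReal_pow (norm_nonneg _), ofReal_norm]
  rw [h3 c hcs, h3 _ hys, ← ENNReal.ofReal_mul (by positivity)]
  exact ENNReal.ofReal_le_ofReal h2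

/-! ### Periodization and Parseval's identity. -/

/-- The multiples of a positive number are indexed by the integers. -/
noncomputable def intEquivZMultiples {T : ℝ} (hT : 0 < T) : ℤ ≃ AddSubgroup.zmultiples T :=
  Equiv.ofInjective (fun n : ℤ => n • T) (zsmul_left_strictMono hT).injective

theorem lintegral_eq_lintegral_tsum_add {T : ℝ} (hT : 0 < T) {f : ℝ → ℝ≥0∞} (hf : Measurable f) :
    ∫⁻ x, f x = ∫⁻ x in Set.Ioc 0 T, ∑' k : ℤ, f (x + T * k) := by
  have hm : ∀ k : ℤ, Measurable fun x : ℝ => f (x + T * k) :=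
    fun k => hf.comp (measurable_add_const _)
  have h := (isAddFundamentalDomain_Ioc hT 0).lintegral_eq_tsum'' f
  rw [zero_add] at h
  rw [lintegral_tsum fun k => (hm k).aemeasurable, h]
  rw [← (intEquivZMultiples hT).tsum_eq]
  refine tsum_congr fun k => lintegral_congr fun x => ?_
  congr 1
  change k • T + x = x + T * k
  rw [zsmul_eq_mul]; ring

theorem integral_eq_integral_tsum_add {T : ℝ} (hT : 0 < T) {f : ℝ → ℂ} (hf : StronglyMeasurable f)
    (hi : Integrable f) : ∫ x, f x = ∫ x in Set.Ioc 0 T, ∑' k : ℤ, f (x + T * k) := by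
  have hm : ∀ k : ℤ, StronglyMeasurable fun x : ℝ => f (x + T * k) :=
    fun k => hf.comp_measurable (measurable_add_const _)
  have h := (isAddFundamentalDomain_Ioc hT 0).integral_eq_tsum'' f hi
  rw [zero_add] at h
  rw [integral_tsum (fun k => (hm k).aestronglyMeasurable), h]
  · rw [← (intEquivZMultiples hT).tsum_eq]
    refine tsum_congr fun k => integral_congr_ae (Eventually.of_forall fun x => ?_)
    change f (k • T + x) = f (x + T * k)
    rw [zsmul_eq_mul]; ring_nf
  · rw [← lintegral_tsum fun k => (hm k).enorm.aemeasurable,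
      ← lintegral_eq_lintegral_tsum_add hT hf.enorm]
    exact hi.2.ne

theorem aestronglyMeasurable_tsum_add {T : ℝ} (hT : 0 < T) {f : ℝ → ℂ} (hf : StronglyMeasurable f)
    (hi : Integrable f) :
    AEStronglyMeasurable (fun x => ∑' k : ℤ, f (x + T * k)) (volume.restrict (Set.Ioc 0 T)) := by
  have hm : ∀ k : ℤ, StronglyMeasurable fun x : ℝ => f (x + T * k) :=
    fun k => hf.comp_measurable (measurable_add_const _)
  have hfin : ∀ᵐ x ∂volume.restrict (Set.Ioc 0 T), ∑' k : ℤ, ‖f (x + T * k)‖ₑ < ∞ := by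
    refine ae_lt_top (Measurable.tsum fun k => (hm k).enorm) ?_
    rw [← lintegral_eq_lintegral_tsum_add hT hf.enorm]
    exact hi.2.ne
  refine aestronglyMeasurable_of_tendsto_ae (u := (atTop : Filter (Finset ℤ)))
    (f := fun s x => ∑ k ∈ s, f (x + T * k))
    (fun s => (Finset.stronglyMeasurable_fun_sum s fun k _ => hm k).aestronglyMeasurable) ?_
  filter_upwards [hfin] with x hx
  exact (tsum_enorm_ne_top_iff_summable_norm.1 hx.ne).of_norm.hasSum

/-- Parseval's identity for the periodization of an integrable function. -/
theorem tsum_enorm_sq_integral_exp_mul {T : ℝ} (hT : 0 < T) {f : ℝ → ℂ}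
    (hf : StronglyMeasurable f) (hi : Integrable f)
    (hF : ∫⁻ x in Set.Ioc 0 T, ‖∑' k : ℤ, f (x + T * k)‖ₑ ^ 2 ≠ ∞) :
    ∑' n : ℤ, ‖∫ x : ℝ, Complex.exp (-(2 * Real.pi * Complex.I * n * x / T)) * f x‖ₑ ^ 2
      = ENNReal.ofReal T * ∫⁻ x in Set.Ioc 0 T, ‖∑' k : ℤ, f (x + T * k)‖ₑ ^ 2 := by
  set F : ℝ → ℂ := fun x => ∑' k : ℤ, f (x + T * k) with hFdef
  have hTc : (T : ℂ) ≠ 0 := by exact_mod_cast hT.ne'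
  have hFm := aestronglyMeasurable_tsum_add hT hf hi
  have hL2 : MemLp F 2 (volume.restrict (Set.Ioc 0 T)) := by
    refine ⟨hFm, ?_⟩
    rw [eLpNorm_lt_top_iff_lintegral_rpow_enorm_lt_top two_ne_zero ENNReal.ofNat_ne_top]
    simpa using hF.lt_top
  have hpars := hasSum_sq_fourierCoeffOn hT hL2
  have hcoef : ∀ n : ℤ, ∫ x : ℝ, Complex.exp (-(2 * Real.pi * Complex.I * n * x / T)) * f x
      = T * fourierCoeffOn hT F n := by
    intro n
    have hexp : Continuous fun x : ℝ =>
        Complex.exp (-(2 * Real.pi * Complex.I * n * x / T)) := by fun_prop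
    have hexpn : ∀ x : ℝ, ‖Complex.exp (-(2 * Real.pi * Complex.I * n * x / T))‖ = 1 := fun x => by
      rw [show (-(2 * Real.pi * Complex.I * n * x / T) : ℂ)
        = ((-(2 * Real.pi * n * x / T) : ℝ) : ℂ) * Complex.I by push_cast; ring,
        Complex.norm_exp_ofReal_mul_I]
    have hper := integral_eq_integral_tsum_add hT (hexp.stronglyMeasurable.mul hf)
      (hi.bdd_mul hexp.aestronglyMeasurable (c := 1) (Eventually.of_forall fun x => (hexpn x).le))
    simp only [Pi.mul_apply] at hper
    rw [hper,
      fourierCoeffOn_eq_integral, intervalIntegral.integral_of_le hT.le, sub_zero]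
    rw [Complex.real_smul, ← mul_assoc]
    push_cast
    rw [mul_one_div_cancel hTc, one_mul]
    refine integral_congr_ae (Eventually.of_forall fun x => ?_)
    simp only [hFdef, smul_eq_mul]
    rw [← tsum_mul_left]
    refine tsum_congr fun k => ?_
    rw [fourier_coe_apply]
    congr 1
    -- The exponential is `T`-periodic, so it factors out of the periodization.
    refine Complex.exp_eq_exp_iff_exists_int.2 ⟨-(n * k), ?_⟩
    push_cast
    field_simp
    ring
  have hint : ∫⁻ x in Set.Ioc 0 T, ‖F x‖ₑ ^ 2 = ENNReal.ofReal (∫ x in (0 : ℝ)..T, ‖F x‖ ^ 2) := by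
    rw [intervalIntegral.integral_of_le hT.le, ofReal_integral_eq_lintegral_ofReal
      hL2.integrable_norm_pow' (Eventually.of_forall fun x => by positivity)]
    refine lintegral_congr fun x => ?_
    rw [ENNReal.ofReal_pow (norm_nonneg _), ofReal_norm]
  rw [hint, ← ENNReal.ofReal_mul hT.le]
  calc ∑' n : ℤ, ‖∫ x : ℝ, Complex.exp (-(2 * Real.pi * Complex.I * n * x / T)) * f x‖ₑ ^ 2
      = ∑' n : ℤ, ENNReal.ofReal (T ^ 2 * ‖fourierCoeffOn hT F n‖ ^ 2) := by
        refine tsum_congr fun n => ?_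
        rw [hcoef, enorm_mul, mul_pow, ENNReal.ofReal_mul (sq_nonneg T),
          ENNReal.ofReal_pow (norm_nonneg _), ofReal_norm, ENNReal.ofReal_pow hT.le,
          ← ofReal_norm (T : ℂ), Complex.norm_of_nonneg hT.le]
    _ = ENNReal.ofReal (T ^ 2 * ((T - 0)⁻¹ • ∫ x in (0 : ℝ)..T, ‖F x‖ ^ 2)) := by
        rw [← (hpars.mul_left (T ^ 2)).tsum_eq, ENNReal.ofReal_tsum_of_nonneg
          (fun n => by positivity) (hpars.mul_left (T ^ 2)).summable]
    _ = _ := by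
        congr 1
        rw [sub_zero, smul_eq_mul]
        field_simp

/-! ### Fiberization and sufficiency. -/

theorem isFrame_iff_enorm {ι H : Type*} [NormedAddCommGroup H] [InnerProductSpace ℂ H]
    (v : ι → H) : IsFrame v ↔ ∃ A B : ℝ, 0 < A ∧ 0 < B ∧ ∀ h : H,
      ENNReal.ofReal A * ‖h‖ₑ ^ 2 ≤ ∑' i, ‖inner ℂ (v i) h‖ₑ ^ 2 ∧
      ∑' i, ‖inner ℂ (v i) h‖ₑ ^ 2 ≤ ENNReal.ofReal B * ‖h‖ₑ ^ 2 := by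
  have hterm : ∀ z : ℂ, ‖z‖ₑ ^ 2 = ENNReal.ofReal (‖z‖ ^ 2) := fun z => by
    rw [ENNReal.ofReal_pow (norm_nonneg _), ofReal_norm]
  have hnorm : ∀ (A : ℝ), 0 < A → ∀ h : H,
      ENNReal.ofReal A * ‖h‖ₑ ^ 2 = ENNReal.ofReal (A * ‖h‖ ^ 2) := fun A hA h => by
    rw [ENNReal.ofReal_mul hA.le, ENNReal.ofReal_pow (norm_nonneg _), ofReal_norm]
  refine exists_congr fun A => exists_congr fun B => and_congr_right fun hA =>
    and_congr_right fun hB => forall_congr' fun h => ?_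
  rw [hnorm A hA, hnorm B hB]
  simp_rw [hterm]
  constructor
  · rintro ⟨hs, h1, h2⟩
    rw [← ENNReal.ofReal_tsum_of_nonneg (fun i => sq_nonneg _) hs]
    exact ⟨ENNReal.ofReal_le_ofReal h1, ENNReal.ofReal_le_ofReal h2⟩
  · rintro ⟨h1, h2⟩
    have hs : Summable fun i => ‖inner ℂ (v i) h‖ ^ 2 :=
      (ENNReal.summable_toReal (h2.trans_lt ENNReal.ofReal_lt_top).ne).congr fun i => by
        rw [ENNReal.toReal_ofReal (sq_nonneg _)]
    rw [← ENNReal.ofReal_tsum_of_nonneg (fun i => sq_nonneg _) hs] at h1 h2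
    exact ⟨hs, (ENNReal.ofReal_le_ofReal_iff (tsum_nonneg fun i => sq_nonneg _)).1 h1,
      (ENNReal.ofReal_le_ofReal_iff (by positivity)).1 h2⟩

theorem enorm_sq_eq_lintegral (h : Lp ℂ 2 (volume : Measure ℝ)) :
    ‖h‖ₑ ^ 2 = ∫⁻ x, ‖h x‖ₑ ^ 2 := by
  rw [Lp.enorm_def, eLpNorm_eq_lintegral_rpow_enorm_toReal two_ne_zero ENNReal.ofNat_ne_top,
    ← ENNReal.rpow_natCast, ← ENNReal.rpow_mul]
  simp

theorem inner_gaborSystem {g : ℝ → ℝ} (hL2 : MemLp (fun x => (g x : ℂ)) 2 volume) (α T : ℝ)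
    (p : ℤ × ℤ) (h : Lp ℂ 2 (volume : Measure ℝ)) :
    inner ℂ (gaborSystem (fun x => (g x : ℂ)) hL2 α T⁻¹ p) h =
      ∫ x : ℝ, Complex.exp (-(2 * Real.pi * Complex.I * p.2 * x / T)) *
        ((g (x - α * p.1) : ℂ) * h x) := by
  rw [L2.inner_def]
  refine integral_congr_ae ?_
  filter_upwards [(memLp_timeFreqShift hL2 (α * p.1) (T⁻¹ * p.2)).coeFn_toLp] with x hx
  rw [gaborSystem, hx, RCLike.inner_apply, timeFreqShift, map_mul, Complex.conj_ofReal,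
    ← Complex.exp_conj]
  simp only [map_mul, Complex.conj_ofReal, Complex.conj_I, map_ofNat]
  rw [mul_comm, mul_assoc]
  congr 2
  push_cast
  ring

theorem measurable_enorm_sq_comp (h : Lp ℂ 2 (volume : Measure ℝ)) :
    Measurable fun x => ‖h x‖ₑ ^ 2 :=
  (Lp.stronglyMeasurable h).enorm.pow_const 2

theorem lintegral_tsum_enorm_sq {T : ℝ} (hT : 0 < T) (h : Lp ℂ 2 (volume : Measure ℝ)) :
    ∫⁻ x in Set.Ioc 0 T, ∑' k : ℤ, ‖h (x + T * k)‖ₑ ^ 2 = ‖h‖ₑ ^ 2 := by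
  rw [enorm_sq_eq_lintegral, ← lintegral_eq_lintegral_tsum_add hT (measurable_enorm_sq_comp h)]

theorem enorm_tsum_ofReal_mul_le {g : ℤ → ℝ} (hg : ∀ k, 0 ≤ g k) (c : ℤ → ℂ) :
    ‖∑' k, (g k : ℂ) * c k‖ₑ ≤ ∑' k, ENNReal.ofReal (g k) * ‖c k‖ₑ := by
  refine enorm_tsum_le_tsum_enorm.trans (ENNReal.tsum_le_tsum fun k => ?_)
  rw [enorm_mul, ← ofReal_norm, Complex.norm_of_nonneg (hg k)]

/-- The fiberization of the frame operator of a Gabor system. -/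
theorem StablyDecreasing.tsum_enorm_sq_inner_gaborSystem {g : ℝ → ℝ}
    (hL2 : MemLp (fun x => (g x : ℂ)) 2 volume)
    (hneg : ∀ x, x < 0 → g x = 0) (hd : StablyDecreasing g) {α T : ℝ} (hα : 0 < α) (hT : 0 < T)
    (h : Lp ℂ 2 (volume : Measure ℝ)) :
    ∑' p, ‖inner ℂ (gaborSystem (fun x => (g x : ℂ)) hL2 α T⁻¹ p) h‖ₑ ^ 2 =
      ENNReal.ofReal T * ∫⁻ x in Set.Ioc 0 T, ∑' m : ℤ,
        ‖∑' k : ℤ, (g (x + T * k - α * m) : ℂ) * h (x + T * k)‖ₑ ^ 2 := by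
  obtain ⟨B, hB0, hB⟩ := hd.exists_tsum_sq_le hneg hα hT
  have hgm := hd.measurable hneg
  have hg0 := hd.nonneg_of_eq_zero hneg
  have hsm : ∀ m : ℤ, StronglyMeasurable fun x : ℝ => (g (x - α * m) : ℂ) * h x := fun m =>
    (Complex.measurable_ofReal.comp (hgm.comp (measurable_id.sub_const _))).stronglyMeasurable.mul
      (Lp.stronglyMeasurable h)
  have hint : ∀ m : ℤ, Integrable fun x : ℝ => (g (x - α * m) : ℂ) * h x := fun m =>
    (hL2.comp_measurePreserving (measurePreserving_sub_right volume (α * m))).integrable_mul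
      (Lp.memLp h)
  -- The Schur bound puts each periodization in `L²(0, T]`, as Parseval requires.
  have hfin : ∀ m : ℤ, ∫⁻ x in Set.Ioc 0 T,
      ‖∑' k : ℤ, (g (x + T * k - α * m) : ℂ) * h (x + T * k)‖ₑ ^ 2 ≠ ∞ := fun m => by
    refine ((lintegral_mono (g := fun x => ENNReal.ofReal B * ∑' k : ℤ, ‖h (x + T * k)‖ₑ ^ 2)
      fun x => ?_).trans_lt ?_).ne
    · refine le_trans ?_ ((ENNReal.le_tsum m).trans (hB x fun k => ‖h (x + T * k)‖ₑ))
      gcongr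
      exact enorm_tsum_ofReal_mul_le (fun k => hg0 _) _
    · rw [lintegral_const_mul' _ _ ENNReal.ofReal_ne_top, lintegral_tsum_enorm_sq hT]
      exact ENNReal.mul_lt_top ENNReal.ofReal_lt_top (ENNReal.pow_lt_top enorm_lt_top)
  rw [ENNReal.tsum_prod', lintegral_tsum fun m =>
    (aestronglyMeasurable_tsum_add hT (hsm m) (hint m)).enorm.pow_const 2,
    ← ENNReal.tsum_mul_left]
  refine tsum_congr fun m => ?_
  rw [← tsum_enorm_sq_integral_exp_mul hT (hsm m) (hint m) (hfin m)]
  refine tsum_congr fun n => ?_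
  rw [inner_gaborSystem]

theorem StablyDecreasing.isFrame_gaborSystem {g : ℝ → ℝ}
    (hL2 : MemLp (fun x => (g x : ℂ)) 2 volume)
    (hneg : ∀ x, x < 0 → g x = 0) (hd : StablyDecreasing g) {α T d : ℝ} (hα : 0 < α)
    (hαT : α ≤ T) (hd0 : 0 < d) (hgd : ∀ x, 0 ≤ x → x < α → d ≤ g x) :
    IsFrame (gaborSystem (fun x => (g x : ℂ)) hL2 α T⁻¹) := by
  have hT : 0 < T := hα.trans_le hαT
  have hg0 := hd.nonneg_of_eq_zero hneg
  obtain ⟨B, hB0, hB⟩ := hd.exists_tsum_sq_le hneg hα hT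
  obtain ⟨A, hA0, hA⟩ := hd.exists_le_tsum_sq hneg hα hαT hd0 hgd
  refine (isFrame_iff_enorm _).2 ⟨T * A, T * B, by positivity, by positivity, fun h => ?_⟩
  rw [hd.tsum_enorm_sq_inner_gaborSystem hL2 hneg hα hT, ENNReal.ofReal_mul hT.le,
    ENNReal.ofReal_mul hT.le, mul_assoc, mul_assoc, ← lintegral_tsum_enorm_sq hT]
  constructor
  · rw [← lintegral_const_mul' (ENNReal.ofReal A) _ ENNReal.ofReal_ne_top]
    refine mul_le_mul_right (lintegral_mono_ae ?_) _
    -- The lower bound on fibers assumes square-summability, which holds for almost every `x`.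
    have hfin : ∀ᵐ x ∂volume.restrict (Set.Ioc 0 T), ∑' k : ℤ, ‖h (x + T * k)‖ₑ ^ 2 < ∞ := by
      refine ae_lt_top (Measurable.tsum fun k =>
        (measurable_enorm_sq_comp h).comp (measurable_add_const _)) ?_
      rw [lintegral_tsum_enorm_sq hT]
      exact (ENNReal.pow_lt_top enorm_lt_top).ne
    filter_upwards [hfin] with x hx
    exact hA x _ hx.ne
  · rw [← lintegral_const_mul' (ENNReal.ofReal B) _ ENNReal.ofReal_ne_top]
    refine mul_le_mul_right (lintegral_mono fun x => ?_) _
    refine le_trans (ENNReal.tsum_le_tsum fun m => ?_) (hB x fun k => ‖h (x + T * k)‖ₑ)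
    gcongr
    exact enorm_tsum_ofReal_mul_le (fun k => hg0 _) _

/-! ### Test functions and necessity. -/

/-- A finitely supported coefficient sequence spread over the translates of a set of phases. -/
theorem exists_Lp_eq_indicator {T : ℝ} (hT : 0 < T) {E : Set ℝ} (hE : MeasurableSet E)
    (hET : E ⊆ Set.Ioc 0 T) {s : Finset ℤ} {c : ℤ → ℂ} (hcs : ∀ k, k ∉ s → c k = 0) :
    ∃ h : Lp ℂ 2 (volume : Measure ℝ), ∀ᵐ x ∂volume.restrict (Set.Ioc 0 T),
      ∀ k : ℤ, h (x + T * k) = E.indicator (fun _ => c k) x := by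
  have hvol : volume E ≠ ∞ := by
    refine ((measure_mono hET).trans_lt ?_).ne
    rw [Real.volume_Ioc]; exact ENNReal.ofReal_lt_top
  have hmem : ∀ k ∈ s, MemLp (fun y : ℝ => E.indicator (fun _ => c k) (y - T * k)) 2 volume :=
    fun k _ => (memLp_indicator_const 2 hE (c k) (Or.inr hvol)).comp_measurePreserving
      (measurePreserving_sub_right volume (T * k))
  have hsum := memLp_finsetSum s hmem
  refine ⟨hsum.toLp _, ?_⟩
  have hcoe : ∀ᵐ x : ℝ, ∀ k : ℤ, hsum.toLp _ (x + T * k) =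
      ∑ j ∈ s, E.indicator (fun _ => c j) (x + T * k - T * j) :=
    ae_all_iff.2 fun k =>
      (measurePreserving_add_right volume (T * (k : ℝ))).quasiMeasurePreserving.ae hsum.coeFn_toLp
  filter_upwards [ae_restrict_mem measurableSet_Ioc, ae_restrict_of_ae hcoe] with x hx hk k
  rw [hk k, Finset.sum_eq_single k]
  · rw [add_sub_cancel_right]
  · intro j _ hjk
    refine Set.indicator_of_notMem (fun hmem => ?_) _
    obtain ⟨h1, h2⟩ := hET hmem
    rcases lt_or_gt_of_ne hjk with h | h
    · have : (j : ℝ) + 1 ≤ k := by exact_mod_cast h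
      nlinarith [hx.1]
    · have : (k : ℝ) + 1 ≤ j := by exact_mod_cast h
      nlinarith [hx.2]
  · intro hks
    simp [hcs k hks]

theorem exists_ne_zero_of_card_lt {M s : Finset ℤ} (h : M.card < s.card) (W : ℤ → ℤ → ℂ) :
    ∃ c : ℤ → ℂ, (∀ k, k ∉ s → c k = 0) ∧ (∃ k, c k ≠ 0) ∧
      ∀ m ∈ M, ∑ k ∈ s, W m k * c k = 0 := by
  classical
  let φ : (s → ℂ) →ₗ[ℂ] (M → ℂ) := Matrix.mulVecLin (Matrix.of fun (m : M) (k : s) => W m k)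
  have hker : LinearMap.ker φ ≠ ⊥ := LinearMap.ker_ne_bot_of_finrank_lt (by simpa using h)
  obtain ⟨b, hb, hb0⟩ := (Submodule.ne_bot_iff _).1 hker
  refine ⟨fun k => if hk : k ∈ s then b ⟨k, hk⟩ else 0, fun k hk => by simp [hk], ?_, ?_⟩
  · obtain ⟨k, hk⟩ := Function.ne_iff.1 hb0
    exact ⟨k, by simpa using hk⟩
  · intro m hm
    have h1 := congrFun (LinearMap.mem_ker.1 hb) ⟨m, hm⟩
    rw [← Finset.sum_coe_sort]
    simpa [φ, Matrix.mulVec, dotProduct] using h1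

namespace StablyDecreasing

variable {g : ℝ → ℝ}

/-- One finite vector `c` nearly annihilated by the matrices for all `x` in a set `E` of positive
measure gives a function with fibers `c` over `E` and `0` elsewhere, which violates the lower frame
bound. -/
theorem not_isFrame_gaborSystem (hL2 : MemLp (fun x => (g x : ℂ)) 2 volume)
    (hneg : ∀ x, x < 0 → g x = 0) (hd : StablyDecreasing g) {α T : ℝ} (hα : 0 < α) (hT : 0 < T)
    (H : ∀ ε : ℝ, 0 < ε → ∃ (E : Set ℝ) (s : Finset ℤ) (c : ℤ → ℂ), MeasurableSet E ∧
      E ⊆ Set.Ioc 0 T ∧ volume E ≠ 0 ∧ (∀ k, k ∉ s → c k = 0) ∧ (∃ k, c k ≠ 0) ∧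
      ∀ x ∈ E, ∑' m : ℤ, ‖∑' k : ℤ, (g (x + T * k - α * m) : ℂ) * c k‖ₑ ^ 2 ≤
        ENNReal.ofReal ε * ∑' k, ‖c k‖ₑ ^ 2) :
    ¬ IsFrame (gaborSystem (fun x => (g x : ℂ)) hL2 α T⁻¹) := by
  rw [isFrame_iff_enorm]
  rintro ⟨A, B, hA, -, hAB⟩
  -- After the factor `T` from fiberization this leaves `A / 2`, contradicting the bound `A`.
  obtain ⟨E, s, c, hE, hET, hvol, hcs, ⟨k₀, hk₀⟩, hbound⟩ := H (A / (2 * T)) (by positivity)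
  obtain ⟨h, hh⟩ := exists_Lp_eq_indicator hT hE hET hcs
  set S : ℝ≥0∞ := ∑' k, ‖c k‖ₑ ^ 2 with hS
  have hS0 : S ≠ 0 := fun h0 => hk₀ (by simpa using ENNReal.tsum_eq_zero.1 h0 k₀)
  have hStop : S ≠ ∞ := by
    rw [hS, tsum_eq_sum (s := s) fun k hk => by simp [hcs k hk]]
    exact ENNReal.sum_ne_top.2 fun k _ => (ENNReal.pow_lt_top enorm_lt_top).ne
  have hvt : volume E ≠ ∞ := by
    refine ((measure_mono hET).trans_lt ?_).ne
    rw [Real.volume_Ioc]; exact ENNReal.ofReal_lt_top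
  have hrestr : ∀ a : ℝ≥0∞, ∫⁻ x in Set.Ioc 0 T, E.indicator (fun _ => a) x = a * volume E := by
    intro a
    rw [lintegral_indicator_const hE, Measure.restrict_apply hE, Set.inter_eq_left.2 hET]
  have hnorm : ‖h‖ₑ ^ 2 = S * volume E := by
    rw [← lintegral_tsum_enorm_sq hT, ← hrestr]
    refine lintegral_congr_ae ?_
    filter_upwards [hh] with x hx
    simp_rw [hx]
    by_cases hxE : x ∈ E <;> simp [hxE, hS]
  have h1 := (hAB h).1
  rw [hd.tsum_enorm_sq_inner_gaborSystem hL2 hneg hα hT, hnorm] at h1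
  have h2 : ∫⁻ x in Set.Ioc 0 T, ∑' m : ℤ,
      ‖∑' k : ℤ, (g (x + T * k - α * m) : ℂ) * h (x + T * k)‖ₑ ^ 2 ≤
        ENNReal.ofReal (A / (2 * T)) * S * volume E := by
    rw [← hrestr]
    refine lintegral_mono_ae ?_
    filter_upwards [hh] with x hx
    simp_rw [hx]
    by_cases hxE : x ∈ E
    · simpa [hxE] using hbound x hxE
    · simp [hxE]
  have h3 := h1.trans (mul_le_mul_right h2 (ENNReal.ofReal T))
  rw [← mul_assoc, ← mul_assoc, ← mul_assoc, ← ENNReal.ofReal_mul hT.le,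
    ENNReal.mul_le_mul_iff_left hvol hvt, ENNReal.mul_le_mul_iff_left hS0 hStop,
    ENNReal.ofReal_le_ofReal_iff (by positivity)] at h3
  have h4 : T * (A / (2 * T)) = A / 2 := by field_simp
  linarith

theorem not_isFrame_gaborSystem_of_tendsto_zero (hL2 : MemLp (fun x => (g x : ℂ)) 2 volume)
    (hneg : ∀ x, x < 0 → g x = 0) (hd : StablyDecreasing g) {α T : ℝ} (hα : 0 < α) (hT : 0 < T)
    (hlim : Tendsto g (𝓝[<] α) (𝓝 0)) (hzero : ∀ x, α < x → g x = 0) :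
    ¬ IsFrame (gaborSystem (fun x => (g x : ℂ)) hL2 α T⁻¹) := by
  refine hd.not_isFrame_gaborSystem hL2 hneg hα hT fun ε hε => ?_
  have hsmall : ∀ᶠ x in 𝓝[<] α, g x ^ 2 < ε := by
    have h := hlim.pow 2
    rw [zero_pow two_ne_zero] at h
    exact h.eventually_lt_const hε
  obtain ⟨l, hl, hlε⟩ := mem_nhdsLT_iff_exists_Ioo_subset.1 hsmall
  -- Chosen so that `α ∈ (Tn, Tn + T]`: points just below `α` are then `x + Tn` with `x ∈ (0, T]`.
  set n : ℤ := ⌈α / T⌉ - 1 with hn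
  have hn1 : T * n < α := by
    have h1 := (lt_div_iff₀ hT).1 (sub_lt_iff_lt_add.2 (Int.ceil_lt_add_one (α / T)))
    rw [hn]; push_cast; linarith
  have hn2 : α ≤ T * n + T := by
    have h1 := (div_le_iff₀ hT).1 (Int.le_ceil (α / T))
    rw [hn]; push_cast; linarith
  refine ⟨Set.Ioo (max (max l 0 - T * n) 0) (α - T * n), {n}, Pi.single n 1, measurableSet_Ioo,
    fun x hx => ⟨(le_max_right _ _).trans_lt hx.1, by linarith [hx.2]⟩, ?_, fun k hk => ?_,
    ⟨n, by simp⟩, fun x hx => ?_⟩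
  · rw [Real.volume_Ioo, ENNReal.ofReal_ne_zero_iff, sub_pos]
    exact max_lt (by linarith [max_lt (Set.mem_Iio.1 hl) hα]) (by linarith)
  · rw [Finset.mem_singleton] at hk
    simp [hk]
  · have hx1 : max l 0 < x + T * n := by
      linarith [(le_max_left (max l 0 - T * n) 0).trans_lt hx.1]
    have hx2 : x + T * n < α := by linarith [hx.2]
    have hxl := (le_max_left l 0).trans_lt hx1
    have hx0 := (le_max_right l 0).trans_lt hx1
    have hk : ∀ m : ℤ, ∑' k : ℤ, (g (x + T * k - α * m) : ℂ) * (Pi.single n 1 : ℤ → ℂ) k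
        = g (x + T * n - α * m) := fun m => by
      rw [tsum_eq_single n fun k hk => by simp [hk]]
      simp
    simp_rw [hk]
    rw [tsum_eq_single (0 : ℤ), tsum_eq_single n fun k hk => by simp [hk]]
    · have h1 : g (x + T * n) ^ 2 < ε := hlε ⟨hxl, hx2⟩
      simp only [Int.cast_zero, mul_zero, sub_zero, Pi.single_eq_same, enorm_one, one_pow, mul_one]
      rw [← ofReal_norm, ← ENNReal.ofReal_pow (norm_nonneg _), Complex.norm_real,
        Real.norm_eq_abs, sq_abs]
      exact ENNReal.ofReal_le_ofReal h1.le
    · intro m hm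
      have : g (x + T * n - α * m) = 0 := by
        rcases lt_or_gt_of_ne hm with h | h
        · have : (m : ℝ) ≤ -1 := by exact_mod_cast Int.le_sub_one_of_lt h
          exact hzero _ (by nlinarith)
        · have : (1 : ℝ) ≤ m := by exact_mod_cast h
          exact hneg _ (by nlinarith)
      simp [this]

/-- On `N` columns, rows from about `NT/α` upwards vanish and rows up to `-I` are at most `q ^ I`
times the rows `I` further up. Fewer than `N` rows remain once `N` is large, so they have a common
kernel vector. -/
theorem not_isFrame_gaborSystem_of_lt (hL2 : MemLp (fun x => (g x : ℂ)) 2 volume)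
    (hneg : ∀ x, x < 0 → g x = 0) (hd : StablyDecreasing g) {α T : ℝ} (hα : 0 < α) (hT : 0 < T)
    (hTα : T < α) : ¬ IsFrame (gaborSystem (fun x => (g x : ℂ)) hL2 α T⁻¹) := by
  refine hd.not_isFrame_gaborSystem hL2 hneg hα hT fun ε hε => ?_
  have hg0 := hd.nonneg_of_eq_zero hneg
  obtain ⟨B, hB0, hB⟩ := hd.exists_tsum_sq_le hneg hα hT
  obtain ⟨q, hq0, hq1, hq⟩ := hd.decreasing α hα
  -- Right limits at `x = 0` give one matrix and hence one kernel vector, which serves approximately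
  -- for all small `x > 0`.
  choose G hG using hd.exists_tendsto_nhdsGT hneg
  obtain ⟨I, hI⟩ : ∃ I : ℕ, (q ^ I) ^ 2 * B ≤ ε / 2 := by
    have h1 : Tendsto (fun n : ℕ => (q ^ n) ^ 2 * B) atTop (𝓝 (0 ^ 2 * B)) :=
      ((tendsto_pow_atTop_nhds_zero_of_lt_one hq0.le hq1).pow 2).mul_const B
    rw [zero_pow two_ne_zero, zero_mul] at h1
    exact (h1.eventually_le_const (half_pos hε)).exists
  -- Equivalent to `NT/α + 1 + I ≤ N`, which gives `P + I < N` for the ceiling `P` of `NT/α`.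
  obtain ⟨N, hN⟩ : ∃ N : ℕ, (I + 1) / (1 - T / α) ≤ (N : ℝ) := exists_nat_ge _
  have hTα1 : 0 < 1 - T / α := sub_pos.2 ((div_lt_one hα).2 hTα)
  set P : ℤ := ⌈T * N / α⌉ with hP
  have hP1 : T * N ≤ α * P := by
    have := (div_le_iff₀ hα).1 (Int.le_ceil (T * N / α)); linarith
  have hP2 : P + I < N := by
    have h1 := Int.ceil_lt_add_one (T * N / α)
    rw [div_le_iff₀ hTα1] at hN
    have h2 : (P : ℝ) + I < N := by
      have : T * N / α = N * (T / α) := by ring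
      linarith
    exact_mod_cast h2
  have hP0 : 0 ≤ P := Int.ceil_nonneg (by positivity)
  set M : Finset ℤ := Finset.Ioo (-(I : ℤ)) P with hM
  set s : Finset ℤ := Finset.Ico 0 (N : ℤ) with hs
  have hcard : M.card < s.card := by
    rw [hM, hs, Int.card_Ioo, Int.card_Ico]
    omega
  obtain ⟨c, hcs, hc0, hcM⟩ := exists_ne_zero_of_card_lt hcard fun m k => (G (T * k - α * m) : ℂ)
  set S : ℝ≥0∞ := ∑' k, ‖c k‖ₑ ^ 2 with hS
  have hS0 : S ≠ 0 := fun h0 => by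
    obtain ⟨k₀, hk₀⟩ := hc0
    exact hk₀ (by simpa using ENNReal.tsum_eq_zero.1 h0 k₀)
  have hfin : ∀ x : ℝ, ∀ m : ℤ, ∑' k : ℤ, (g (x + T * k - α * m) : ℂ) * c k =
      ∑ k ∈ s, (g (x + T * k - α * m) : ℂ) * c k := fun x m =>
    tsum_eq_sum fun k hk => by rw [hcs k hk, mul_zero]
  have hlim : Tendsto (fun x : ℝ => ∑ m ∈ M, ‖∑ k ∈ s, (g (x + T * k - α * m) : ℂ) * c k‖ₑ ^ 2)
      (𝓝[>] 0) (𝓝 0) := by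
    have h1 : Tendsto (fun x : ℝ => ∑ m ∈ M, ‖∑ k ∈ s, (g (x + T * k - α * m) : ℂ) * c k‖ₑ ^ 2)
        (𝓝[>] 0) (𝓝 (∑ m ∈ M, ‖∑ k ∈ s, (G (T * k - α * m) : ℂ) * c k‖ₑ ^ 2)) := by
      refine tendsto_finsetSum _ fun m _ => ENNReal.Tendsto.pow ?_
      refine (continuous_enorm.tendsto _).comp (tendsto_finsetSum _ fun k _ => ?_)
      refine Tendsto.mul_const _ ((Complex.continuous_ofReal.tendsto _).comp ?_)
      refine (hG (T * k - α * m)).comp (tendsto_nhdsWithin_iff.2 ⟨?_, ?_⟩)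
      · refine tendsto_nhdsWithin_of_tendsto_nhds ?_
        have : Continuous fun x : ℝ => x + T * k - α * m := by fun_prop
        simpa using this.tendsto 0
      · filter_upwards [self_mem_nhdsWithin] with x hx
        have := Set.mem_Ioi.1 hx
        rw [Set.mem_Ioi]; linarith
    rwa [Finset.sum_eq_zero fun m hm => by rw [hcM m hm]; simp] at h1
  have hpos : 0 < ENNReal.ofReal (ε / 2) * S :=
    ENNReal.mul_pos (by simpa using hε) hS0
  obtain ⟨u, hu, huS⟩ := mem_nhdsGT_iff_exists_Ioo_subset.1 (hlim.eventually_lt_const hpos)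
  rw [Set.mem_Ioi] at hu
  refine ⟨Set.Ioo 0 (min u T), s, c, measurableSet_Ioo,
    fun x hx => ⟨hx.1, (hx.2.trans_le (min_le_right _ _)).le⟩, ?_, hcs, hc0, fun x hx => ?_⟩
  · rw [Real.volume_Ioo, ENNReal.ofReal_ne_zero_iff, sub_zero]
    exact lt_min hu hT
  have hxu : ∑ m ∈ M, ‖∑ k ∈ s, (g (x + T * k - α * m) : ℂ) * c k‖ₑ ^ 2
      < ENNReal.ofReal (ε / 2) * S := huS ⟨hx.1, hx.2.trans_le (min_le_left _ _)⟩
  have hxT : x < T := hx.2.trans_le (min_le_right _ _)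
  have hx0 : 0 < x := hx.1
  set Y : ℤ → ℝ≥0∞ := fun m => ‖∑ k ∈ s, (g (x + T * k - α * m) : ℂ) * c k‖ₑ ^ 2 with hY
  set Z : ℤ → ℝ≥0∞ := fun m =>
    (∑' k : ℤ, ENNReal.ofReal (g (x + T * k - α * m)) * ‖c k‖ₑ) ^ 2 with hZ
  have hrow : ∀ m, Y m ≤ (M : Set ℤ).indicator Y m
      + ENNReal.ofReal ((q ^ I) ^ 2) * Z (Equiv.addRight (I : ℤ) m) := by
    intro m
    by_cases hm : m ∈ M
    · simp [hm]
    rcases le_or_gt P m with hPm | hPm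
    · have : Y m = 0 := by
        rw [hY]
        simp only
        rw [Finset.sum_eq_zero fun k hk => ?_]
        · simp
        · have hk1 : (k : ℝ) ≤ N - 1 := by
            have := (Finset.mem_Ico.1 hk).2
            exact_mod_cast Int.le_sub_one_of_lt this
          have hm1 : (P : ℝ) ≤ m := by exact_mod_cast hPm
          rw [hneg _ (by nlinarith)]
          simp
      rw [this]; exact zero_le
    · have hmI : m ≤ -(I : ℤ) := by
        by_contra h
        exact hm (Finset.mem_Ioo.2 ⟨by omega, hPm⟩)
      refine le_trans ?_ le_add_self
      have hmI' : (m : ℝ) + I ≤ 0 := by exact_mod_cast (by omega : m + I ≤ 0)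
      simp only [hY, hZ]
      rw [← hfin, ENNReal.ofReal_pow (by positivity), ← mul_pow]
      gcongr
      refine (enorm_tsum_ofReal_mul_le (fun k => hg0 _) _).trans ?_
      rw [← ENNReal.tsum_mul_left]
      refine ENNReal.tsum_le_tsum fun k => ?_
      by_cases hk : k ∈ s
      · rw [← mul_assoc, ← ENNReal.ofReal_mul (by positivity)]
        gcongr
        have hk0 : (0 : ℝ) ≤ k := by exact_mod_cast (Finset.mem_Ico.1 hk).1
        have h1 := le_pow_mul hq0.le hα.le hq
          (x := x + T * k - α * ((Equiv.addRight (I : ℤ) m : ℤ) : ℝ)) ?_ I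
        · refine le_trans (le_of_eq ?_) h1
          congr 1
          simp only [Equiv.coe_addRight]; push_cast; ring
        · simp only [Equiv.coe_addRight]; push_cast
          nlinarith [mul_nonneg hT.le hk0]
      · simp [hcs k hk]
  simp_rw [hfin]
  calc ∑' m, Y m ≤ ∑' m, ((M : Set ℤ).indicator Y m
        + ENNReal.ofReal ((q ^ I) ^ 2) * Z (Equiv.addRight (I : ℤ) m)) := ENNReal.tsum_le_tsum hrow
    _ = ∑ m ∈ M, Y m + ENNReal.ofReal ((q ^ I) ^ 2) * ∑' m, Z m := by
        rw [ENNReal.tsum_add, ENNReal.tsum_mul_left, (Equiv.addRight (I : ℤ)).tsum_eq,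
          ← sum_eq_tsum_indicator]
    _ ≤ ENNReal.ofReal (ε / 2) * S + ENNReal.ofReal ((q ^ I) ^ 2) * (ENNReal.ofReal B * S) :=
        add_le_add hxu.le (mul_le_mul_right (hB x fun k => ‖c k‖ₑ) _)
    _ ≤ ENNReal.ofReal (ε / 2) * S + ENNReal.ofReal (ε / 2) * S := by
        rw [← mul_assoc, ← ENNReal.ofReal_mul (by positivity)]
        gcongr
    _ = ENNReal.ofReal ε * S := by
        rw [← add_mul, ← ENNReal.ofReal_add (by positivity) (by positivity), add_halves]

/-! ### The endpoint `x₀` and the main theorem. -/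

theorem pos_of_lt_supPos (hd : StablyDecreasing g) {x : ℝ} (hx0 : 0 ≤ x)
    (hx : ENNReal.ofReal x < supPos g) : 0 < g x := by
  obtain ⟨y, hy⟩ := lt_iSup_iff.1 hx
  obtain ⟨⟨hy0, hgy⟩, hxy⟩ := lt_iSup_iff.1 hy
  exact hgy.trans_le (hd.antitoneOn hx0 hy0 ((ENNReal.ofReal_lt_ofReal_iff_of_nonneg hx0).1 hxy).le)

theorem eq_zero_of_supPos_lt (hd : StablyDecreasing g) {x : ℝ} (hx0 : 0 ≤ x)
    (hx : supPos g < ENNReal.ofReal x) : g x = 0 := by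
  by_contra h
  exact hx.not_ge (le_iSup₂_of_le x ⟨hx0, (hd.nonneg x hx0).lt_of_ne' h⟩ le_rfl)

end StablyDecreasing

theorem mainTheorem1 (g : ℝ → ℝ) (hL2 : MemLp (fun x => (g x : ℂ)) 2 volume)
    (hneg : ∀ x, x < 0 → g x = 0) (hdec : StablyDecreasing g) :
    (supPos g = ∞ → ∀ α β : ℝ, 0 < α → 0 < β →
      (IsFrame (gaborSystem (fun x => (g x : ℂ)) hL2 α β) ↔ α * β ≤ 1)) ∧
    (supPos g < ∞ → ∃ L : ℝ, 0 ≤ L ∧ Tendsto g (𝓝[<] (supPos g).toReal) (𝓝 L) ∧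
      (0 < L → ∀ α β : ℝ, 0 < α → 0 < β →
        (IsFrame (gaborSystem (fun x => (g x : ℂ)) hL2 α β) ↔
          α * β ≤ 1 ∧ α ≤ (supPos g).toReal)) ∧
      (L = 0 → ∀ α β : ℝ, 0 < α → 0 < β →
        (IsFrame (gaborSystem (fun x => (g x : ℂ)) hL2 α β) ↔
          α * β ≤ 1 ∧ α < (supPos g).toReal))) := by
  have hdens : ∀ α β : ℝ, 0 < α → 0 < β →
      IsFrame (gaborSystem (fun x => (g x : ℂ)) hL2 α β) → α * β ≤ 1 := by
    intro α β hα hβ hf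
    by_contra! h
    rw [← inv_inv β] at hf
    refine hdec.not_isFrame_gaborSystem_of_lt hL2 hneg hα (inv_pos.2 hβ) ?_ hf
    rwa [inv_lt_iff_one_lt_mul₀ hβ]
  have hsuff : ∀ α β d : ℝ, 0 < α → 0 < β → α * β ≤ 1 → 0 < d →
      (∀ x, 0 ≤ x → x < α → d ≤ g x) →
      IsFrame (gaborSystem (fun x => (g x : ℂ)) hL2 α β) := by
    intro α β d hα hβ h hd0 hd
    rw [← inv_inv β]
    refine hdec.isFrame_gaborSystem hL2 hneg hα ?_ hd0 hd
    rwa [le_inv_comm₀ hα hβ, ← one_div, le_div_iff₀ hα, mul_comm]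
  have hsuff' : ∀ α β : ℝ, 0 < α → 0 < β → α * β ≤ 1 → ENNReal.ofReal α < supPos g →
      IsFrame (gaborSystem (fun x => (g x : ℂ)) hL2 α β) := fun α β hα hβ h hlt =>
    -- By monotonicity `g α > 0` bounds `g` from below on `[0, α)`.
    hsuff α β (g α) hα hβ h (hdec.pos_of_lt_supPos hα.le hlt) fun x hx0 hxα =>
      hdec.antitoneOn hx0 hα.le hxα.le
  refine ⟨fun htop α β hα hβ => ⟨hdens α β hα hβ, fun h => ?_⟩, fun hfin => ?_⟩
  · exact hsuff' α β hα hβ h (htop ▸ ENNReal.ofReal_lt_top)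
  obtain ⟨L, hL0, hLlim, hL⟩ := hdec.exists_tendsto_nhdsLT hneg (supPos g).toReal
  have hzero : ∀ x, (supPos g).toReal < x → g x = 0 := fun x hx =>
    hdec.eq_zero_of_supPos_lt (ENNReal.toReal_nonneg.trans hx.le)
      ((ENNReal.lt_ofReal_iff_toReal_lt hfin.ne).2 hx)
  have hnot : ∀ α β : ℝ, 0 < α → 0 < β → (supPos g).toReal < α →
      ¬ IsFrame (gaborSystem (fun x => (g x : ℂ)) hL2 α β) := by
    intro α β hα hβ hlt
    rw [← inv_inv β]
    refine hdec.not_isFrame_gaborSystem_of_tendsto_zero hL2 hneg hα (inv_pos.2 hβ) ?_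
      fun x hx => hzero x (hlt.trans hx)
    refine tendsto_const_nhds.congr' ?_
    filter_upwards [mem_nhdsWithin_of_mem_nhds (Ioi_mem_nhds hlt)] with x hx
    exact (hzero x hx).symm
  refine ⟨L, hL0, hLlim, fun hLpos α β hα hβ => ⟨fun hf => ?_, fun h => ?_⟩,
    fun hLz α β hα hβ => ⟨fun hf => ?_, fun h => ?_⟩⟩
  · exact ⟨hdens α β hα hβ hf, not_lt.1 fun hlt => hnot α β hα hβ hlt hf⟩
  · exact hsuff α β L hα hβ h.1 hLpos fun x hx0 hxα => hL x hx0 (hxα.trans_le h.2)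
  · refine ⟨hdens α β hα hβ hf, ?_⟩
    by_contra! hle
    rcases hle.eq_or_lt with heq | hlt
    · rw [← inv_inv β] at hf
      subst hLz
      rw [heq] at hLlim hzero
      exact hdec.not_isFrame_gaborSystem_of_tendsto_zero hL2 hneg hα (inv_pos.2 hβ) hLlim hzero hf
    · exact hnot α β hα hβ hlt hf
  · exact hsuff' α β hα hβ h.1 ((ENNReal.ofReal_lt_iff_lt_toReal hα.le hfin.ne).2 h.2)
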